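/- Let $\mathfrak h$ be a complex Hilbert space (scalar product antilinear in the first argument) with an anti-unitary involution $\Gamma$, i.e. $\Gamma$ is antilinear, $\Gamma^2=1$ and $\langle\Gamma f,\Gamma g\rangle=\langle g,f\rangle$. Let $P$ be a basis projection, i.e. an orthogonal projection on $\mathfrak h$ with $P+\Gamma P\Gamma=1$, and put $\mathfrak p:=P\mathfrak h$. Let $\mathfrak F=\bigoplus_{n\ge 0}\bigwedge^n\mathfrak p$ be the antisymmetric Fock space over $\mathfrak p$ (Hilbert space direct sum, with $\langle p_1\wedge\dots\wedge p_n,\,p_1'\wedge\dots\wedge p_n'\rangle=\det(\langle p_i,p_j'\rangle)_{i,j}$) with vacuum vector $\Omega$, the unit vector $1\in\bigwedge^0\mathfrak p=\mathbb C$. For $p\in\mathfrak p$ let $c(p)$ be the bounded annihilation operator on $\mathfrak F$, determined by $c(p)\Omega=0$ and $$c(p)(p_1\wedge\dots\wedge p_n)=\sum_{r=1}^n(-1)^{r-1}\langle p,p_r\rangle\,p_1\wedge\dots\wedge\widehat{p_r}\wedge\dots\wedge p_n ,$$ whose adjoint satisfies $c(p)^*\Omega=p$ and $c(p)^*(p_1\wedge\dots\wedge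 p_n)=p\wedge p_1\wedge\dots\wedge p_n$. For $f\in\mathfrak h$ put $a(f):=c(P\Gamma f)^*+c(Pf)$. For a closed $\Gamma$-invariant subspace $\mathfrak q\subseteq\mathfrak h$ let $\mathcal M(\mathfrak q):=\{a(q)\mid q\in\mathfrak q\}''$ be the von Neumann algebra on $\mathfrak F$ generated by the operators $a(q)$, $q\in\mathfrak q$. Then: (i) $\Omega$ is cyclic for $\mathcal M(\mathfrak q)$ (i.e. $\mathcal M(\mathfrak q)\Omega$ is dense in $\mathfrak F$) if and only if $P\mathfrak q$ is dense in $\mathfrak p$. (ii) $\Omega$ is separating for $\mathcal M(\mathfrak q)$ (i.e. $A\in\mathcal M(\mathfrak q)$ and $A\Omega=0$ imply $A=0$) if and only if $P(\mathfrak q^\perp)$ is dense in $\mathfrak p$. -/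

import Mathlib

open scoped ComplexConjugate InnerProductSpace

/-! ## The algebraic antisymmetric Fock space

For a complex inner product space `E`, the algebraic direct sum of the exterior powers of `E` is
`ExteriorAlgebra ℂ E`, with vacuum `1`. -/

namespace Fock

noncomputable section

variable {E : Type*} [NormedAddCommGroup E] [InnerProductSpace ℂ E]

/-- `v ∧ ·` on the exterior algebra. -/
def wedge (v : E) : ExteriorAlgebra ℂ E →ₗ[ℂ] ExteriorAlgebra ℂ E :=
  LinearMap.mulLeft ℂ (ExteriorAlgebra.ι ℂ v)

/-- The contraction `v₁ ∧ … ∧ vₙ ↦ ∑ r, (-1) ^ (r - 1) ⟪v, v_r⟫ v₁ ∧ … ∧ v̂_r ∧ … ∧ vₙ` on the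
exterior algebra; it kills the vacuum. -/
def contract (v : E) : ExteriorAlgebra ℂ E →ₗ[ℂ] ExteriorAlgebra ℂ E :=
  CliffordAlgebra.contractLeft (Q := (0 : QuadraticForm ℂ E)) (innerSL ℂ v).toLinearMap

@[simp] theorem wedge_apply (v : E) (x : ExteriorAlgebra ℂ E) :
    wedge v x = ExteriorAlgebra.ι ℂ v * x := rfl

@[simp] theorem contract_one (v : E) : contract v 1 = 0 :=
  CliffordAlgebra.contractLeft_one _ _

@[simp] theorem contract_algebraMap (v : E) (r : ℂ) :
    contract v (algebraMap ℂ (ExteriorAlgebra ℂ E) r) = 0 :=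
  CliffordAlgebra.contractLeft_algebraMap _ _ _

theorem contract_wedge (v w : E) (x : ExteriorAlgebra ℂ E) :
    contract v (wedge w x) = ⟪v, w⟫_ℂ • x - wedge w (contract v x) :=
  CliffordAlgebra.contractLeft_ι_mul _ _ _

theorem contract_contract (v : E) (x : ExteriorAlgebra ℂ E) : contract v (contract v x) = 0 :=
  CliffordAlgebra.contractLeft_contractLeft _ _

theorem wedge_wedge (v : E) (x : ExteriorAlgebra ℂ E) : wedge v (wedge v x) = 0 := by
  simp [← mul_assoc]

theorem contract_add (v w : E) (x : ExteriorAlgebra ℂ E) :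
    contract (v + w) x = contract v x + contract w x := by
  have h : (innerSL ℂ (v + w)).toLinearMap
      = (innerSL ℂ v).toLinearMap + (innerSL ℂ w).toLinearMap := by
    ext z; simp
  rw [contract, h, map_add]
  rfl

theorem contract_smul (r : ℂ) (v : E) (x : ExteriorAlgebra ℂ E) :
    contract (r • v) x = conj r • contract v x := by
  have h : (innerSL ℂ (r • v)).toLinearMap = conj r • (innerSL ℂ v).toLinearMap := by
    ext z; simp
  rw [contract, h, map_smul]
  rfl

theorem wedge_induction {p : ExteriorAlgebra ℂ E → Prop}
    (algebraMap : ∀ r, p (algebraMap ℂ _ r)) (add : ∀ x y, p x → p y → p (x + y))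
    (wedge : ∀ v x, p x → p (wedge v x)) (x : ExteriorAlgebra ℂ E) : p x :=
  CliffordAlgebra.left_induction (Q := 0) algebraMap add (fun x v hx => wedge v x hx) x

/-- Precomposition of antilinear functionals with contractions. -/
def preContract : E →ₗ[ℂ] (ExteriorAlgebra ℂ E →ₗ⋆[ℂ] ℂ) →ₗ[ℂ] (ExteriorAlgebra ℂ E →ₗ⋆[ℂ] ℂ) :=
  LinearMap.mk₂ ℂ (fun v φ => φ.comp (contract v))
    (fun v w φ => by ext x; simp [contract_add])
    (fun r v φ => by ext x; simp [contract_smul])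
    (fun v φ ψ => by ext x; simp)
    (fun r v φ => by ext x; simp)

/-- `y ↦ ⟪·, y⟫`, by recursion on `y`: `⟪x, 1⟫` is the conjugate of the degree zero part of `x`, and
`⟪x, v ∧ y⟫ = ⟪contract v x, y⟫`. On exterior products this is the Gram determinant,
`⟪v₁ ∧ … ∧ vₙ, w₁ ∧ … ∧ wₙ⟫ = det ⟪vᵢ, wⱼ⟫`, and different exterior powers are orthogonal. -/
def form : ExteriorAlgebra ℂ E →ₗ[ℂ] (ExteriorAlgebra ℂ E →ₗ⋆[ℂ] ℂ) :=
  CliffordAlgebra.foldr (0 : QuadraticForm ℂ E) preContract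
    (fun v φ => by ext x; simp [preContract, contract_contract])
    ((starLinearEquiv ℂ (A := ℂ)).toLinearMap.comp
      (ExteriorAlgebra.algebraMapInv (R := ℂ) (M := E)).toLinearMap)

theorem form_wedge (v : E) (x y : ExteriorAlgebra ℂ E) :
    form (wedge v y) x = form y (contract v x) := by
  have h : form (wedge v y) = preContract v (form y) := by
    unfold form
    erw [CliffordAlgebra.foldr_mul, CliffordAlgebra.foldr_ι]
  rw [h]; rfl

theorem form_algebraMap (r : ℂ) (x : ExteriorAlgebra ℂ E) :
    form (algebraMap ℂ _ r) x = r * conj (ExteriorAlgebra.algebraMapInv x) := by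
  have h : form (algebraMap ℂ (ExteriorAlgebra ℂ E) r) = r • _ :=
    CliffordAlgebra.foldr_algebraMap _ _ _ _ _
  rw [h]; rfl

theorem algebraMapInv_wedge (v : E) (x : ExteriorAlgebra ℂ E) :
    ExteriorAlgebra.algebraMapInv (wedge v x) = 0 := by
  simp [ExteriorAlgebra.algebraMapInv]

theorem form_wedge_right (v : E) (x y : ExteriorAlgebra ℂ E) :
    form y (wedge v x) = form (contract v y) x := by
  induction y using wedge_induction generalizing x with
  | algebraMap r => simp [form_algebraMap, algebraMapInv_wedge, -wedge_apply]
  | add y z hy hz => simp only [map_add, LinearMap.add_apply, hy, hz]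
  | wedge w y ih =>
    simp only [form_wedge, contract_wedge, map_sub, ih, LinearMap.sub_apply,
      LinearMap.map_smulₛₗ, LinearMap.smul_apply, inner_conj_symm, RingHom.id_apply]

theorem form_symm (x y : ExteriorAlgebra ℂ E) : conj (form x y) = form y x := by
  induction y using wedge_induction generalizing x with
  | algebraMap r =>
    rw [form_algebraMap]
    induction x using wedge_induction with
    | algebraMap s => simp [form_algebraMap, ExteriorAlgebra.algebraMap_leftInverse E _, mul_comm]
    | add x z hx hz => simp only [map_add, LinearMap.add_apply, hx, hz, mul_add]
    | wedge v x ih => simp [form_wedge, algebraMapInv_wedge, -wedge_apply]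
  | add y z hy hz => simp only [map_add, LinearMap.add_apply, hy, hz]
  | wedge v y ih => rw [form_wedge_right, ih, form_wedge]

/-- The exterior products of sublists of `l` span these vectors. -/
def InSpan : List E → ExteriorAlgebra ℂ E → Prop
  | [], x => ∃ r, x = algebraMap ℂ _ r
  | e :: l, x => ∃ y z, InSpan l y ∧ InSpan l z ∧ x = y + wedge e z

theorem InSpan.add {l : List E} {x y : ExteriorAlgebra ℂ E} (hx : InSpan l x) (hy : InSpan l y) :
    InSpan l (x + y) := by
  induction l generalizing x y with
  | nil =>
    obtain ⟨r, rfl⟩ := hx; obtain ⟨s, rfl⟩ := hy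
    exact ⟨r + s, by simp⟩
  | cons e l ih =>
    obtain ⟨a, b, ha, hb, rfl⟩ := hx; obtain ⟨c, d, hc, hd, rfl⟩ := hy
    exact ⟨a + c, b + d, ih ha hc, ih hb hd, by rw [map_add]; abel⟩

theorem InSpan.smul {l : List E} {x : ExteriorAlgebra ℂ E} (r : ℂ) (hx : InSpan l x) :
    InSpan l (r • x) := by
  induction l generalizing x with
  | nil =>
    obtain ⟨s, rfl⟩ := hx
    exact ⟨r * s, by simp [Algebra.smul_def]⟩
  | cons e l ih =>
    obtain ⟨a, b, ha, hb, rfl⟩ := hx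
    exact ⟨r • a, r • b, ih ha, ih hb, by rw [map_smul, smul_add]⟩

theorem InSpan.algebraMap (l : List E) (r : ℂ) : InSpan l (algebraMap ℂ _ r) := by
  induction l with
  | nil => exact ⟨r, rfl⟩
  | cons e l ih =>
    exact ⟨_, 0, ih, by simpa using InSpan.smul 0 ih, by simp⟩

theorem wedge_comm (v w : E) (x : ExteriorAlgebra ℂ E) :
    wedge v (wedge w x) = (-1 : ℂ) • wedge w (wedge v x) := by
  have h := wedge_wedge (v + w) x
  have h1 := wedge_wedge v x
  have h2 := wedge_wedge w x
  simp only [wedge_apply, map_add, add_mul] at h h1 h2 ⊢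
  rw [h1, h2, zero_add, add_zero] at h
  rw [neg_smul, one_smul]
  exact eq_neg_of_add_eq_zero_left (by rw [add_comm]; exact h)

theorem InSpan.wedge_mem {l : List E} {x : ExteriorAlgebra ℂ E} {v : E} (hv : v ∈ l)
    (hx : InSpan l x) : InSpan l (wedge v x) := by
  induction l generalizing x with
  | nil => simp at hv
  | cons e l ih =>
    obtain ⟨a, b, ha, hb, rfl⟩ := hx
    rcases List.mem_cons.1 hv with rfl | hv
    · exact ⟨0, a, by simpa using InSpan.algebraMap l 0, ha, by
        rw [map_add, wedge_wedge, add_zero, zero_add]⟩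
    · exact ⟨_, _, ih hv ha, (ih hv hb).smul (-1), by
        rw [map_add, wedge_comm v e, map_smul]⟩

theorem InSpan.wedge_span {l : List E} {x : ExteriorAlgebra ℂ E} {v : E}
    (hv : v ∈ Submodule.span ℂ {e | e ∈ l}) (hx : InSpan l x) : InSpan l (wedge v x) := by
  induction hv using Submodule.span_induction with
  | mem v hv => exact hx.wedge_mem hv
  | zero => simpa using InSpan.algebraMap l 0
  | add v w _ _ hv hw => simpa [add_mul] using hv.add hw
  | smul r v _ hv => simpa using hv.smul r

theorem InSpan.contract_eq_zero {l : List E} {x : ExteriorAlgebra ℂ E} {v : E}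
    (hv : ∀ e ∈ l, ⟪v, e⟫_ℂ = 0) (hx : InSpan l x) : contract v x = 0 := by
  induction l generalizing x with
  | nil => obtain ⟨r, rfl⟩ := hx; simp
  | cons e l ih =>
    obtain ⟨a, b, ha, hb, rfl⟩ := hx
    have hl : ∀ e ∈ l, ⟪v, e⟫_ℂ = 0 := fun e he => hv e (List.mem_cons_of_mem _ he)
    rw [map_add, contract_wedge, ih hl ha, ih hl hb, hv e List.mem_cons_self]
    simp

theorem InSpan.form_pos {l : List E} (hl : l.Pairwise fun v w => ⟪v, w⟫_ℂ = 0)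
    (hl1 : ∀ e ∈ l, ⟪e, e⟫_ℂ = 1) {x : ExteriorAlgebra ℂ E} (hx : InSpan l x) :
    0 ≤ (form x x).re ∧ (form x x = 0 → x = 0) := by
  have key : 0 ≤ (form x x).re ∧ ((form x x).re = 0 → x = 0) := by
    induction l generalizing x with
    | nil =>
      obtain ⟨r, rfl⟩ := hx
      rw [form_algebraMap, ExteriorAlgebra.algebraMap_leftInverse E r, Complex.mul_conj]
      refine ⟨by simpa using Complex.normSq_nonneg r, fun h => ?_⟩
      have hr : r = 0 := Complex.normSq_eq_zero.1 (by simpa using h)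
      rw [hr, map_zero]
    | cons e l ih =>
      obtain ⟨a, b, ha, hb, rfl⟩ := hx
      obtain ⟨he, hl⟩ := List.pairwise_cons.1 hl
      have hl1' : ∀ e ∈ l, ⟪e, e⟫_ℂ = 1 := fun e he => hl1 e (List.mem_cons_of_mem _ he)
      have ca := InSpan.contract_eq_zero (v := e) he ha
      have cb := InSpan.contract_eq_zero (v := e) he hb
      have h : form (a + wedge e b) (a + wedge e b) = form a a + form b b := by
        rw [map_add, map_add, LinearMap.add_apply, LinearMap.add_apply, form_wedge, form_wedge,
          form_wedge_right, contract_wedge, ca, cb, hl1 e List.mem_cons_self]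
        simp
      obtain ⟨ha0, ha1⟩ := ih hl hl1' ha
      obtain ⟨hb0, hb1⟩ := ih hl hl1' hb
      rw [h, Complex.add_re]
      refine ⟨add_nonneg ha0 hb0, fun h0 => ?_⟩
      rw [ha1 (by linarith), hb1 (by linarith)]
      simp
  exact ⟨key.1, fun h => key.2 (by rw [h, Complex.zero_re])⟩

theorem exists_finiteDimensional (x : ExteriorAlgebra ℂ E) :
    ∃ F : Submodule ℂ E, FiniteDimensional ℂ F ∧
      x ∈ Algebra.adjoin ℂ (ExteriorAlgebra.ι ℂ '' (F : Set E)) := by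
  have mono : ∀ F G : Submodule ℂ E, F ≤ G →
      Algebra.adjoin ℂ (ExteriorAlgebra.ι ℂ '' (F : Set E))
        ≤ Algebra.adjoin ℂ (ExteriorAlgebra.ι ℂ '' (G : Set E)) := fun F G h =>
    Algebra.adjoin_mono (Set.image_mono h)
  induction x using wedge_induction with
  | algebraMap r => exact ⟨⊥, inferInstance, Subalgebra.algebraMap_mem _ r⟩
  | add x y hx hy =>
    obtain ⟨F, hF, hx⟩ := hx; obtain ⟨G, hG, hy⟩ := hy
    exact ⟨F ⊔ G, inferInstance, add_mem (mono _ _ le_sup_left hx) (mono _ _ le_sup_right hy)⟩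
  | wedge v x hx =>
    obtain ⟨F, hF, hx⟩ := hx
    refine ⟨Submodule.span ℂ {v} ⊔ F, inferInstance, mul_mem (Algebra.subset_adjoin ?_)
      (mono _ _ le_sup_right hx)⟩
    exact ⟨v, (le_sup_left : _ ≤ Submodule.span ℂ {v} ⊔ F) (Submodule.mem_span_singleton_self v),
      rfl⟩

theorem exists_inSpan (x : ExteriorAlgebra ℂ E) :
    ∃ l : List E, (l.Pairwise fun v w => ⟪v, w⟫_ℂ = 0) ∧ (∀ e ∈ l, ⟪e, e⟫_ℂ = 1) ∧ InSpan l x := by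
  obtain ⟨F, hF, hx⟩ := exists_finiteDimensional x
  let b := stdOrthonormalBasis ℂ F
  let l : List E := List.ofFn fun i => (b i : E)
  have hspan : ∀ v ∈ F, v ∈ Submodule.span ℂ {e | e ∈ l} := by
    intro v hv
    have h := b.sum_repr ⟨v, hv⟩
    have h' : v = ∑ i, b.repr ⟨v, hv⟩ i • (b i : E) := by
      simpa using (congrArg (Subtype.val) h).symm
    rw [h']
    exact Submodule.sum_mem _ fun i _ => Submodule.smul_mem _ _
      (Submodule.subset_span (List.mem_ofFn.2 ⟨i, rfl⟩))
  refine ⟨l, ?_, ?_, ?_⟩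
  · refine List.pairwise_ofFn.2 fun i j hij => ?_
    simpa using b.orthonormal.2 hij.ne
  · intro e he
    obtain ⟨i, rfl⟩ := List.mem_ofFn.1 he
    have h1 : ‖((b i : F) : E)‖ = 1 := b.orthonormal.1 i
    rw [inner_self_eq_norm_sq_to_K, h1]
    simp
  · have h : ∀ y, InSpan l y → InSpan l (x * y) := by
      induction hx using Algebra.adjoin_induction with
      | mem x hx =>
        obtain ⟨v, hv, rfl⟩ := hx
        exact fun y hy => hy.wedge_span (hspan v hv)
      | algebraMap r => exact fun y hy => by simpa [Algebra.smul_def] using hy.smul r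
      | add a b _ _ ha hb => exact fun y hy => by simpa [add_mul] using (ha y hy).add (hb y hy)
      | mul a b _ _ ha hb => exact fun y hy => by simpa [mul_assoc] using ha _ (hb y hy)
    simpa using h 1 (by simpa using InSpan.algebraMap l 1)

/-- The inner product of the algebraic Fock space. -/
abbrev core : InnerProductSpace.Core ℂ (ExteriorAlgebra ℂ E) where
  inner x y := form y x
  conj_inner_symm x y := form_symm x y
  re_inner_nonneg x := by
    obtain ⟨l, h1, h2, h3⟩ := exists_inSpan x
    exact (h3.form_pos h1 h2).1
  add_left x y z := by simp
  smul_left x y r := by simp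
  definite x h := by
    obtain ⟨l, h1, h2, h3⟩ := exists_inSpan x
    exact (h3.form_pos h1 h2).2 h

instance instNormedAddCommGroup : NormedAddCommGroup (ExteriorAlgebra ℂ E) := (core (E := E)).toNormedAddCommGroup

instance instInnerProductSpace : InnerProductSpace ℂ (ExteriorAlgebra ℂ E) :=
  InnerProductSpace.ofCore (core (E := E)).toCore

theorem inner_wedge_left (v : E) (x y : ExteriorAlgebra ℂ E) :
    ⟪wedge v x, y⟫_ℂ = ⟪x, contract v y⟫_ℂ := form_wedge_right v x y

theorem inner_wedge_right (v : E) (x y : ExteriorAlgebra ℂ E) :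
    ⟪x, wedge v y⟫_ℂ = ⟪contract v x, y⟫_ℂ := form_wedge v x y

theorem norm_sq_add_norm_sq (v : E) (x : ExteriorAlgebra ℂ E) :
    ‖contract v x‖ ^ 2 + ‖wedge v x‖ ^ 2 = (‖v‖ * ‖x‖) ^ 2 := by
  have h : ⟪contract v x, contract v x⟫_ℂ + ⟪wedge v x, wedge v x⟫_ℂ
      = ⟪v, v⟫_ℂ * ⟪x, x⟫_ℂ := by
    rw [inner_wedge_left, contract_wedge, inner_sub_right, inner_smul_right, inner_wedge_right]
    ring
  simp only [inner_self_eq_norm_sq_to_K] at h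
  rw [mul_pow]
  exact_mod_cast h

end

end Fock

/-! ## The antisymmetric Fock space, annihilation and creation operators -/

noncomputable section

/-- The antisymmetric Fock space over `E`: the Hilbert space completion of the orthogonal direct sum
of the exterior powers of `E`. -/
def FockSpace (E : Type*) [NormedAddCommGroup E] [InnerProductSpace ℂ E] : Type _ :=
  UniformSpace.Completion (ExteriorAlgebra ℂ E)

namespace FockSpace

variable {E : Type*} [NormedAddCommGroup E] [InnerProductSpace ℂ E]

instance instNormedAddCommGroup : NormedAddCommGroup (FockSpace E) :=
  inferInstanceAs (NormedAddCommGroup (UniformSpace.Completion (ExteriorAlgebra ℂ E)))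

instance instInnerProductSpace : InnerProductSpace ℂ (FockSpace E) :=
  inferInstanceAs (InnerProductSpace ℂ (UniformSpace.Completion (ExteriorAlgebra ℂ E)))

instance instCompleteSpace : CompleteSpace (FockSpace E) :=
  inferInstanceAs (CompleteSpace (UniformSpace.Completion (ExteriorAlgebra ℂ E)))

/-- The inclusion of the algebraic direct sum of the exterior powers into the Fock space. -/
def of : ExteriorAlgebra ℂ E →ₗᵢ[ℂ] FockSpace E :=
  UniformSpace.Completion.toComplₗᵢ

theorem denseRange_of : DenseRange (of : ExteriorAlgebra ℂ E → FockSpace E) :=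
  UniformSpace.Completion.denseRange_coe

variable (E) in
/-- The Fock vacuum `Ω`. -/
def vacuum : FockSpace E := of 1

/-- The bounded extension of an operator on the exterior algebra to the Fock space. -/
def extend (T : ExteriorAlgebra ℂ E →L[ℂ] ExteriorAlgebra ℂ E) : FockSpace E →L[ℂ] FockSpace E :=
  ContinuousLinearMap.completion T

theorem extend_of (T : ExteriorAlgebra ℂ E →L[ℂ] ExteriorAlgebra ℂ E) (x : ExteriorAlgebra ℂ E) :
    extend T (of x) = of (T x) :=
  ContinuousLinearMap.completion_apply_coe T x

attribute [irreducible] instNormedAddCommGroup instInnerProductSpace of extend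

/-- The annihilation operator `c(v)`, the bounded operator on the Fock space that extends the
contraction with `v`. -/
def annihilation (v : E) : FockSpace E →L[ℂ] FockSpace E :=
  extend ((Fock.contract v).mkContinuous ‖v‖ fun x =>
    le_of_sq_le_sq (by nlinarith [Fock.norm_sq_add_norm_sq v x, sq_nonneg ‖Fock.wedge v x‖])
      (by positivity))

/-- The creation operator `c(v)^*`, the bounded operator on the Fock space that extends `v ∧ ·`. -/
def creation (v : E) : FockSpace E →L[ℂ] FockSpace E :=
  extend ((Fock.wedge v).mkContinuous ‖v‖ fun x =>
    le_of_sq_le_sq (by nlinarith [Fock.norm_sq_add_norm_sq v x, sq_nonneg ‖Fock.contract v x‖])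
      (by positivity))

theorem annihilation_of (v : E) (x : ExteriorAlgebra ℂ E) :
    annihilation v (of x) = of (Fock.contract v x) :=
  extend_of _ _

theorem creation_of (v : E) (x : ExteriorAlgebra ℂ E) :
    creation v (of x) = of (Fock.wedge v x) :=
  extend_of _ _

theorem star_annihilation (v : E) : star (annihilation v) = creation v := by
  rw [ContinuousLinearMap.star_eq_adjoint]
  symm
  rw [ContinuousLinearMap.eq_adjoint_iff]
  intro x y
  induction x using denseRange_of.induction_on with
  | hp => exact isClosed_eq (by fun_prop) (by fun_prop)
  | ih x =>
    induction y using denseRange_of.induction_on with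
    | hp => exact isClosed_eq (by fun_prop) (by fun_prop)
    | ih y =>
      rw [annihilation_of, creation_of, LinearIsometry.inner_map_map, LinearIsometry.inner_map_map,
        Fock.inner_wedge_left]

end FockSpace

/-! ## The self-dual CAR algebra in a Fock representation -/

variable {H : Type*} [NormedAddCommGroup H] [InnerProductSpace ℂ H]

/-- An anti-unitary involution `Γ` of a complex Hilbert space. -/
structure AntiunitaryInvolution (H : Type*) [NormedAddCommGroup H] [InnerProductSpace ℂ H]
    extends H →ₗ⋆[ℂ] H where
  involutive : ∀ f, toLinearMap (toLinearMap f) = f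
  inner_map_map : ∀ f g, ⟪toLinearMap f, toLinearMap g⟫_ℂ = ⟪g, f⟫_ℂ

instance AntiunitaryInvolution.instCoeFun : CoeFun (AntiunitaryInvolution H) fun _ => H → H := ⟨fun Γ => ⇑Γ.toLinearMap⟩

/-- A basis projection of `(H, Γ)`: an orthogonal projection `P` with `P + Γ P Γ = 1`. -/
structure BasisProjection [CompleteSpace H] (Γ : AntiunitaryInvolution H) where
  /-- the underlying operator -/
  proj : H →L[ℂ] H
  isStarProjection : IsStarProjection proj
  add_conj : ∀ f, proj f + Γ (proj (Γ f)) = f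

namespace BasisProjection

variable [CompleteSpace H] {Γ : AntiunitaryInvolution H} (P : BasisProjection Γ)

/-- The one-particle space `p = P H`. -/
abbrev oneParticle : Submodule ℂ H := P.proj.range

/-- `P`, as a map from `H` to the one-particle space. -/
def toOneParticle (f : H) : P.oneParticle := ⟨P.proj f, f, rfl⟩

/-- The generators `a(f) = c(P Γ f)^* + c(P f)` in the Fock representation given by `P`. -/
def a (f : H) : FockSpace P.oneParticle →L[ℂ] FockSpace P.oneParticle :=
  FockSpace.creation (P.toOneParticle (Γ f)) + FockSpace.annihilation (P.toOneParticle f)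

theorem star_a (f : H) : star (P.a f) = P.a (Γ f) := by
  rw [a, a, star_add, FockSpace.star_annihilation, ← FockSpace.star_annihilation, star_star,
    add_comm]
  congr 3
  exact (Γ.involutive f).symm

/-- The von Neumann algebra `M(q)`, the double commutant of the operators `a(f)` with `f ∈ q`, for a
`Γ`-invariant subspace `q`. -/
def vonNeumannAlgebra (q : Submodule ℂ H) (hq : ∀ f ∈ q, Γ f ∈ q) :
    VonNeumannAlgebra (FockSpace P.oneParticle) where
  toSubalgebra := Subalgebra.centralizer ℂ (Set.centralizer (P.a '' (q : Set H)))
  star_mem' := by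
    have hS : star (P.a '' (q : Set H)) = P.a '' (q : Set H) := by
      refine Set.Subset.antisymm ?_ ?_
      · rintro A ⟨f, hf, hA⟩
        exact ⟨Γ f, hq f hf, by rw [← P.star_a, hA, star_star]⟩
      · rintro A ⟨f, hf, rfl⟩
        exact ⟨Γ f, hq f hf, (P.star_a f).symm⟩
    intro A hA
    change star A ∈ Set.centralizer (Set.centralizer (P.a '' (q : Set H)))
    rw [← hS, ← Set.star_centralizer, ← Set.star_centralizer]
    exact Set.star_mem_star.2 hA
  centralizer_centralizer' := Set.centralizer_centralizer_centralizer _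

end BasisProjection

/-! ## Cyclic and separating vectors -/

section

variable {F : Type*} [NormedAddCommGroup F] [InnerProductSpace ℂ F] [CompleteSpace F]

/-- `ξ` is cyclic for `M`: the subspace `M ξ` is dense. -/
def VonNeumannAlgebra.IsCyclic (M : VonNeumannAlgebra F) (ξ : F) : Prop :=
  Dense {x : F | ∃ A ∈ M, A ξ = x}

/-- `ξ` is separating for `M`: an element of `M` that annihilates `ξ` is zero. -/
def VonNeumannAlgebra.IsSeparating (M : VonNeumannAlgebra F) (ξ : F) : Prop :=
  ∀ A ∈ M, A ξ = 0 → A = 0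

end

end

/-! Everything rests on the self-dual CAR `a_mul_a`, $a(f)a(g)+a(g)a(f)=\langle g,\Gamma f\rangle
1$, and on the parity $\theta=(-1)^N$, which anticommutes with every $a(f)$ and fixes $\Omega$. For
$f\in\mathfrak q$ and $g\perp\mathfrak q$ the generators anticommute, so $a(g)\theta$ lies in the
commutant of $\mathcal M(\mathfrak q)$. Only this easy inclusion of twisted duality is needed.

Density gives cyclicity: $a(\Gamma f)=c(Pf)^*+c(P\Gamma f)$, and
`eq_top_of_creation_add_annihilation_mem` shows that the annihilation parts do no harm, so that
$\Omega$ generates the whole Fock space. For separation the same lemma, applied to $\mathfrak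
q^\perp$, fills the Fock space with vectors killed by a given $A\in\mathcal M(\mathfrak q)$ with
$A\Omega=0$.

Conversely, if density fails, some $v\ne0$ in $\mathfrak p$ is orthogonal to $P\mathfrak q$,
respectively $P(\mathfrak q^\perp)$, hence to $\mathfrak q$, respectively $\mathfrak q^\perp$. Since
$P\Gamma v=0$, $a(v)=c(v)$ is a nonzero operator that kills $\Omega$. In the first case $c(v)\theta$
is in the commutant, contradicting cyclicity; in the second $v\in\mathfrak q^{\perp\perp}=\mathfrak
q$ and $c(v)\in\mathcal M(\mathfrak q)$, contradicting separation. -/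

/-! ### Parity on the exterior algebra -/

namespace Fock

noncomputable section

variable {E : Type*} [NormedAddCommGroup E] [InnerProductSpace ℂ E]

/-- The parity operator `(-1) ^ N` on the exterior algebra. -/
def parity : ExteriorAlgebra ℂ E →ₗ[ℂ] ExteriorAlgebra ℂ E :=
  (CliffordAlgebra.involute (Q := (0 : QuadraticForm ℂ E))).toLinearMap

@[simp] theorem parity_algebraMap (r : ℂ) :
    parity (algebraMap ℂ (ExteriorAlgebra ℂ E) r) = algebraMap ℂ _ r :=
  AlgHom.commutes (CliffordAlgebra.involute (Q := (0 : QuadraticForm ℂ E))) r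

theorem parity_wedge (v : E) (x : ExteriorAlgebra ℂ E) :
    parity (wedge v x) = -wedge v (parity x) := by
  have h : CliffordAlgebra.involute (ExteriorAlgebra.ι ℂ v * x)
      = -(ExteriorAlgebra.ι ℂ v) * CliffordAlgebra.involute x :=
    (map_mul CliffordAlgebra.involute _ _).trans
      (congrArg (· * CliffordAlgebra.involute x) (CliffordAlgebra.involute_ι v))
  exact h.trans (neg_mul _ _)

theorem contract_parity (v : E) (x : ExteriorAlgebra ℂ E) :
    contract v (parity x) = -parity (contract v x) := by
  induction x using wedge_induction with
  | algebraMap r => simp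
  | add x y hx hy => simp only [map_add, hx, hy, neg_add]
  | wedge w x ih =>
    simp only [parity_wedge, map_neg, contract_wedge, ih, map_sub, map_smul, neg_sub]

theorem parity_parity (x : ExteriorAlgebra ℂ E) : parity (parity x) = x :=
  CliffordAlgebra.involute_involute x

theorem algebraMapInv_parity (x : ExteriorAlgebra ℂ E) :
    ExteriorAlgebra.algebraMapInv (parity x) = ExteriorAlgebra.algebraMapInv x := by
  induction x using wedge_induction with
  | algebraMap r => simp
  | add x y hx hy => simp only [map_add, hx, hy]
  | wedge v x ih => rw [parity_wedge, map_neg, algebraMapInv_wedge, algebraMapInv_wedge, neg_zero]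

theorem form_parity (x y : ExteriorAlgebra ℂ E) : form (parity y) (parity x) = form y x := by
  induction y using wedge_induction generalizing x with
  | algebraMap r => simp only [parity_algebraMap, form_algebraMap, algebraMapInv_parity]
  | add y z hy hz => simp only [map_add, LinearMap.add_apply, hy, hz]
  | wedge v y ih =>
    rw [parity_wedge, map_neg, LinearMap.neg_apply, form_wedge, form_wedge, contract_parity,
      map_neg, neg_neg, ih]

theorem norm_parity (x : ExteriorAlgebra ℂ E) : ‖parity x‖ = ‖x‖ := by
  have h : ⟪parity x, parity x⟫_ℂ = ⟪x, x⟫_ℂ := form_parity x x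
  rw [@norm_eq_sqrt_re_inner ℂ, @norm_eq_sqrt_re_inner ℂ, h]

end

end Fock

/-! ### Parity, the CAR and generation from the vacuum on the Fock space -/

noncomputable section

namespace FockSpace

variable {E : Type*} [NormedAddCommGroup E] [InnerProductSpace ℂ E]

/-- The parity operator `(-1) ^ N` on the Fock space. -/
def parity : FockSpace E →L[ℂ] FockSpace E :=
  extend (Fock.parity.mkContinuous 1 fun x => by rw [Fock.norm_parity, one_mul])

theorem parity_of (x : ExteriorAlgebra ℂ E) : parity (of x) = of (Fock.parity x) :=
  extend_of _ _

theorem clm_ext {S T : FockSpace E →L[ℂ] FockSpace E}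
    (h : ∀ x : ExteriorAlgebra ℂ E, S (of x) = T (of x)) : S = T :=
  ContinuousLinearMap.ext fun y =>
    congrFun (denseRange_of.equalizer S.continuous T.continuous (funext h)) y

@[simp] theorem parity_vacuum : parity (vacuum E) = vacuum E := by
  have h := Fock.parity_algebraMap (E := E) 1
  rw [map_one] at h
  rw [vacuum, parity_of, h]

theorem parity_mul_parity : (parity : FockSpace E →L[ℂ] FockSpace E) * parity = 1 :=
  clm_ext fun x => by
    rw [mul_apply_eq_comp, parity_of, parity_of, Fock.parity_parity]; rfl

@[simp] theorem annihilation_vacuum (v : E) : annihilation v (vacuum E) = 0 := by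
  rw [vacuum, annihilation_of, Fock.contract_one, map_zero]

theorem parity_mul_annihilation (v : E) : parity * annihilation v = -(annihilation v * parity) :=
  clm_ext fun x => by
    simp only [mul_apply_eq_comp, neg_apply, parity_of,
      annihilation_of, Fock.contract_parity, map_neg, neg_neg]

theorem parity_mul_creation (v : E) : parity * creation v = -(creation v * parity) :=
  clm_ext fun x => by
    simp only [mul_apply_eq_comp, neg_apply, parity_of,
      creation_of, Fock.parity_wedge, map_neg]

theorem annihilation_mul_creation (v w : E) :
    annihilation v * creation w = ⟪v, w⟫_ℂ • 1 - creation w * annihilation v :=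
  clm_ext fun x => by
    simp only [mul_apply_eq_comp, sub_apply,
      smul_apply, one_apply_eq_self, annihilation_of,
      creation_of, Fock.contract_wedge, map_sub, map_smul]

theorem creation_sub (v w : E) : creation (v - w) = creation v - creation w :=
  clm_ext fun x => by
    rw [sub_apply, creation_of, creation_of, creation_of, ← map_sub]
    simp only [Fock.wedge_apply, map_sub, sub_mul]

theorem creation_mul_creation (v w : E) :
    creation v * creation w = -(creation w * creation v) :=
  clm_ext fun x => by
    simp only [mul_apply_eq_comp, neg_apply, creation_of]
    rw [Fock.wedge_comm, neg_smul, one_smul, map_neg]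

theorem annihilation_mul_annihilation (v w : E) :
    annihilation v * annihilation w = -(annihilation w * annihilation v) := by
  have h := congrArg star (creation_mul_creation w v)
  simpa only [star_mul, star_neg, ← star_annihilation, star_star] using h

theorem norm_creation_le (v : E) : ‖creation v‖ ≤ ‖v‖ := by
  refine ContinuousLinearMap.opNorm_le_bound _ (norm_nonneg v) fun y => ?_
  induction y using denseRange_of.induction_on with
  | hp => exact isClosed_le (by fun_prop) (by fun_prop)
  | ih x =>
    rw [creation_of, LinearIsometry.norm_map, LinearIsometry.norm_map]
    exact le_of_sq_le_sq (by
      nlinarith [Fock.norm_sq_add_norm_sq v x, sq_nonneg ‖Fock.contract v x‖]) (by positivity)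

/-- Linearity and `norm_creation_le` give the Lipschitz constant $\|y\|$. This extends stability
under $c(v)^*$ from a dense set of $v$ to all $v$. -/
theorem continuous_creation_apply (y : FockSpace E) : Continuous fun v : E => creation v y := by
  refine (LipschitzWith.of_dist_le_mul (K := ‖y‖₊) fun v w => ?_).continuous
  rw [dist_eq_norm, dist_eq_norm, ← sub_apply, ← creation_sub, mul_comm]
  exact (creation (v - w)).le_of_opNorm_le (norm_creation_le _) y

theorem eq_zero_of_annihilation_eq_zero {v : E} (h : annihilation v = 0) : v = 0 := by
  -- If $c(v)=0$, the CAR applied to $\Omega$ reads $0=\langle v,v\rangle\Omega$.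
  have h1 := congrArg (· (vacuum E)) (annihilation_mul_creation v v)
  simp only [h, zero_mul, mul_zero, sub_zero, zero_apply,
    smul_apply, one_apply_eq_self] at h1
  have hvac : vacuum E ≠ 0 := by
    exact (map_ne_zero_iff of of.injective).2 one_ne_zero
  exact inner_self_eq_zero.1 ((smul_eq_zero.1 h1.symm).resolve_right hvac)

/-- Iterated wedges applied to scalars span the exterior algebra, which is dense. -/
theorem eq_top_of_creation_mem {T : Submodule ℂ (FockSpace E)} (hT : IsClosed (T : Set (FockSpace E)))
    (hvac : vacuum E ∈ T) (h : ∀ v, ∀ y ∈ T, creation v y ∈ T) : T = ⊤ := by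
  have hof : ∀ x : ExteriorAlgebra ℂ E, of x ∈ T := by
    intro x
    induction x using Fock.wedge_induction with
    | algebraMap r =>
      rw [Algebra.algebraMap_eq_smul_one, map_smul]
      exact T.smul_mem r hvac
    | add x y hx hy => rw [map_add]; exact T.add_mem hx hy
    | wedge v x hx => rw [← creation_of]; exact h v _ hx
  refine Submodule.eq_top_iff'.2 fun y => ?_
  induction y using denseRange_of.induction_on with
  | hp => exact hT
  | ih x => exact hof x

/-- Products of annihilation operators, the first entry of the list acting first. -/
def annihilations : List E → FockSpace E →L[ℂ] FockSpace E
  | [] => 1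
  | w :: l => annihilations l * annihilation w

theorem annihilations_vacuum_mem {K : Submodule ℂ (FockSpace E)} (hvac : vacuum E ∈ K) :
    ∀ l : List E, annihilations l (vacuum E) ∈ K
  | [] => hvac
  | w :: l => by
    rw [annihilations, mul_apply_eq_comp, annihilation_vacuum, map_zero]
    exact K.zero_mem

/-- A closed subspace that contains the vacuum and is stable under `c(v)^* + c(w_v)` for `v` in a
dense set is the whole Fock space. -/
theorem eq_top_of_creation_add_annihilation_mem {K : Submodule ℂ (FockSpace E)}
    (hK : IsClosed (K : Set (FockSpace E))) (hvac : vacuum E ∈ K) {D : Set E} (hD : Dense D)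
    (h : ∀ v ∈ D, ∃ w : E, ∀ y ∈ K, (creation v + annihilation w) y ∈ K) : K = ⊤ := by
  -- $K$ itself need not be stable under annihilation, so pass to the vectors all of whose iterated
  -- annihilations stay in $K$. This subspace is closed, contains $\Omega$ and is stable under every
  -- $c(u)$.
  let T : Submodule ℂ (FockSpace E) := ⨅ l : List E, K.comap (annihilations l).toLinearMap
  have mem_T : ∀ y, y ∈ T ↔ ∀ l : List E, annihilations l y ∈ K := fun y => by
    simp [T, Submodule.mem_iInf]
  have hTc : IsClosed (T : Set (FockSpace E)) := by
    have : (T : Set (FockSpace E)) = ⋂ l : List E, annihilations l ⁻¹' (K : Set (FockSpace E)) := by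
      ext y; simp [mem_T]
    rw [this]
    exact isClosed_iInter fun l => hK.preimage (annihilations l).continuous
  -- Induction on the list: the CAR moves $c(v)^*$ past each annihilator until none is left. Then
  -- $c(v)^*y=(c(v)^*+c(w))y-c(w)y$, with both terms in $K$.
  have key : ∀ v ∈ D, ∀ l : List E, ∀ y ∈ T, annihilations l (creation v y) ∈ K := by
    intro v hv l
    obtain ⟨w, hw⟩ := h v hv
    induction l with
    | nil =>
      intro y hy
      have h1 := hw y ((mem_T y).1 hy [])
      have h2 : annihilation w y ∈ K := (mem_T y).1 hy [w]
      simpa [annihilations] using K.sub_mem h1 h2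
    | cons u l ih =>
      intro y hy
      have hu : annihilation u y ∈ T := (mem_T _).2 fun m => (mem_T y).1 hy (u :: m)
      have e : annihilation u (creation v y) = ⟪u, v⟫_ℂ • y - creation v (annihilation u y) :=
        congrArg (· y) (annihilation_mul_creation u v)
      rw [annihilations, mul_apply_eq_comp, e, map_sub, map_smul]
      exact K.sub_mem (K.smul_mem _ ((mem_T y).1 hy l)) (ih _ hu)
  have hT : T = ⊤ := by
    refine eq_top_of_creation_mem hTc ((mem_T _).2 (annihilations_vacuum_mem hvac)) fun v y hy => ?_
    have hcl : IsClosed {v : E | creation v y ∈ T} := hTc.preimage (continuous_creation_apply y)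
    exact hcl.closure_subset_iff.2 (fun v hv => (mem_T _).2 fun l => key v hv l y hy) (hD v)
  refine Submodule.eq_top_iff'.2 fun y => ?_
  exact (mem_T y).1 (hT ▸ Submodule.mem_top) []

end FockSpace

/-! ### The involution and orthogonal complements -/

namespace AntiunitaryInvolution

variable {H : Type*} [NormedAddCommGroup H] [InnerProductSpace ℂ H] (Γ : AntiunitaryInvolution H)

theorem inner_map_right (f g : H) : ⟪f, Γ g⟫_ℂ = ⟪g, Γ f⟫_ℂ := by
  rw [← Γ.inner_map_map, Γ.involutive]

theorem map_mem_orthogonal {q : Submodule ℂ H} (hq : ∀ f ∈ q, Γ f ∈ q) {g : H} (hg : g ∈ qᗮ) :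
    Γ g ∈ qᗮ := by
  intro f hf
  rw [Γ.inner_map_right]
  exact Submodule.inner_left_of_mem_orthogonal (hq f hf) hg

end AntiunitaryInvolution

/-! ### The self-dual CAR and the twisted commutant -/

namespace BasisProjection

open FockSpace

variable {H : Type*} [NormedAddCommGroup H] [InnerProductSpace ℂ H] [CompleteSpace H]
  {Γ : AntiunitaryInvolution H} (P : BasisProjection Γ)

theorem inner_proj_left (f g : H) : ⟪P.proj f, g⟫_ℂ = ⟪f, P.proj g⟫_ℂ :=
  P.isStarProjection.isSelfAdjoint.isSymmetric f g

theorem proj_proj (f : H) : P.proj (P.proj f) = P.proj f :=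
  congrArg (· f) P.isStarProjection.isIdempotentElem

theorem proj_coe (v : P.oneParticle) : P.proj v = v := by
  obtain ⟨_, f, rfl⟩ := v
  exact P.proj_proj f

theorem toOneParticle_coe (v : P.oneParticle) : P.toOneParticle v = v :=
  Subtype.ext (P.proj_coe v)

theorem inner_toOneParticle_right (v : P.oneParticle) (f : H) :
    ⟪v, P.toOneParticle f⟫_ℂ = ⟪(v : H), f⟫_ℂ := by
  change ⟪(v : H), P.proj f⟫_ℂ = _
  rw [← inner_proj_left, proj_coe]

/-- As $Pv=v$, the identity $P+\Gamma P\Gamma=1$ leaves $\Gamma P\Gamma v=0$. -/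
theorem toOneParticle_conj_coe (v : P.oneParticle) : P.toOneParticle (Γ (v : H)) = 0 := by
  have h := P.add_conj (v : H)
  rw [P.proj_coe, add_eq_left] at h
  refine Subtype.ext (?_ : P.proj (Γ (v : H)) = 0)
  rw [← Γ.involutive (P.proj _), h]
  exact map_zero Γ.toLinearMap

theorem a_coe (v : P.oneParticle) : P.a (v : H) = annihilation v := by
  have h : (creation (0 : P.oneParticle)) = 0 := by simpa using creation_sub (0 : P.oneParticle) 0
  rw [a, toOneParticle_conj_coe, h, zero_add, toOneParticle_coe]

/-- The first summand equals $\langle g,\Gamma P\Gamma(\Gamma f)\rangle$ and the second $\langle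
g,P\Gamma f\rangle$, so $P+\Gamma P\Gamma=1$ applies. This is the scalar in the self-dual CAR. -/
theorem inner_proj_conj_add (f g : H) :
    ⟪P.proj f, P.proj (Γ g)⟫_ℂ + ⟪P.proj g, P.proj (Γ f)⟫_ℂ = ⟪g, Γ f⟫_ℂ := by
  rw [inner_proj_left, proj_proj, inner_proj_left, proj_proj]
  have h : ⟪f, P.proj (Γ g)⟫_ℂ = ⟪g, Γ (P.proj (Γ (Γ f)))⟫_ℂ := by
    rw [Γ.inner_map_right g, Γ.involutive, inner_proj_left]
  rw [h, ← inner_add_right, add_comm, P.add_conj]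

theorem a_mul_a (f g : H) : P.a f * P.a g = ⟪g, Γ f⟫_ℂ • 1 - P.a g * P.a f := by
  have h1 := annihilation_mul_creation (P.toOneParticle f) (P.toOneParticle (Γ g))
  have h2 := annihilation_mul_creation (P.toOneParticle g) (P.toOneParticle (Γ f))
  have h3 := creation_mul_creation (P.toOneParticle (Γ f)) (P.toOneParticle (Γ g))
  have h4 := annihilation_mul_annihilation (P.toOneParticle f) (P.toOneParticle g)
  have h5 : ⟪P.toOneParticle f, P.toOneParticle (Γ g)⟫_ℂ
      + ⟪P.toOneParticle g, P.toOneParticle (Γ f)⟫_ℂ = ⟪g, Γ f⟫_ℂ := P.inner_proj_conj_add f g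
  rw [← h5, add_smul]
  simp only [a, add_mul, mul_add]
  rw [h1, h2, h3, h4]
  abel

theorem parity_mul_a (f : H) : parity * P.a f = -(P.a f * parity) := by
  rw [a, mul_add, add_mul, parity_mul_annihilation, parity_mul_creation, neg_add]

/-- An operator that anticommutes with the generators commutes with them after a twist by the
parity. -/
theorem mul_parity_mem_centralizer {q : Submodule ℂ H}
    {B : FockSpace P.oneParticle →L[ℂ] FockSpace P.oneParticle}
    (hB : ∀ f ∈ q, P.a f * B = -(B * P.a f)) :
    B * parity ∈ Set.centralizer (P.a '' (q : Set H)) := by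
  rintro _ ⟨f, hf, rfl⟩
  -- The sign from $B$ cancels the sign from the parity.
  rw [← mul_assoc, hB f hf, mul_assoc B, parity_mul_a, neg_mul, mul_neg, mul_assoc]

theorem a_mem_vonNeumannAlgebra {q : Submodule ℂ H} (hq : ∀ f ∈ q, Γ f ∈ q) {f : H} (hf : f ∈ q) :
    P.a f ∈ P.vonNeumannAlgebra q hq :=
  Set.subset_centralizer_centralizer (Set.mem_image_of_mem _ hf)

theorem commute_of_mem_vonNeumannAlgebra {q : Submodule ℂ H} {hq : ∀ f ∈ q, Γ f ∈ q}
    {A B : FockSpace P.oneParticle →L[ℂ] FockSpace P.oneParticle}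
    (hA : A ∈ P.vonNeumannAlgebra q hq) (hB : B ∈ Set.centralizer (P.a '' (q : Set H))) :
    B * A = A * B :=
  hA B hB

/-- The image of a subspace under the projection onto the one-particle space. -/
def mapOneParticle (q : Submodule ℂ H) : Submodule ℂ P.oneParticle :=
  q.map P.proj.toLinearMap.rangeRestrict

theorem coe_mapOneParticle (q : Submodule ℂ H) :
    (P.mapOneParticle q : Set P.oneParticle) = P.toOneParticle '' (q : Set H) := rfl

/-- The range of a projection is its fixed-point set, hence closed. Completeness lets density in
$\mathfrak p$ be tested by orthogonal vectors. -/
theorem isComplete_oneParticle : IsComplete (P.oneParticle : Set H) := by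
  have h : (P.oneParticle : Set H) = {f | P.proj f = f} := by
    ext f
    exact ⟨fun hf => P.proj_coe ⟨f, hf⟩, fun hf => ⟨f, hf⟩⟩
  rw [h]
  exact (isClosed_eq P.proj.continuous continuous_id).isComplete

theorem dense_toOneParticle_image (q : Submodule ℂ H)
    (h : ∀ v : P.oneParticle, (∀ f ∈ q, ⟪v, P.toOneParticle f⟫_ℂ = 0) → v = 0) :
    Dense (P.toOneParticle '' (q : Set H)) := by
  have : CompleteSpace P.oneParticle := P.isComplete_oneParticle.completeSpace_coe
  rw [← coe_mapOneParticle, Submodule.dense_iff_topologicalClosure_eq_top,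
    Submodule.topologicalClosure_eq_top_iff, Submodule.eq_bot_iff]
  intro v hv
  refine h v fun f hf => ?_
  exact Submodule.inner_left_of_mem_orthogonal
    (show P.toOneParticle f ∈ P.mapOneParticle q from ⟨f, hf, rfl⟩) hv

theorem eq_top_of_a_mem {q : Submodule ℂ H} (hq : ∀ f ∈ q, Γ f ∈ q)
    (hd : Dense (P.toOneParticle '' (q : Set H))) {K : Submodule ℂ (FockSpace P.oneParticle)}
    (hK : IsClosed (K : Set (FockSpace P.oneParticle))) (hvac : vacuum P.oneParticle ∈ K)
    (h : ∀ f ∈ q, ∀ y ∈ K, P.a f y ∈ K) : K = ⊤ := by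
  refine eq_top_of_creation_add_annihilation_mem hK hvac hd ?_
  rintro _ ⟨f, hf, rfl⟩
  refine ⟨P.toOneParticle (Γ f), fun y hy => ?_⟩
  -- Using $\Gamma f$ in place of $f$ puts $Pf$ into the creation part.
  have h1 := h (Γ f) (hq f hf) y hy
  rwa [a, Γ.involutive] at h1

/-! ### Cyclicity and separation -/

theorem isCyclic_of_dense {q : Submodule ℂ H} (hq : ∀ f ∈ q, Γ f ∈ q)
    (hd : Dense (P.toOneParticle '' (q : Set H))) :
    (P.vonNeumannAlgebra q hq).IsCyclic (vacuum P.oneParticle) := by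
  let M := P.vonNeumannAlgebra q hq
  let K : Submodule ℂ (FockSpace P.oneParticle) :=
    { carrier := {x | ∃ A ∈ M, A (vacuum P.oneParticle) = x}
      add_mem' := by
        rintro _ _ ⟨A, hA, rfl⟩ ⟨B, hB, rfl⟩
        exact ⟨A + B, add_mem hA hB, rfl⟩
      zero_mem' := ⟨0, zero_mem M, rfl⟩
      smul_mem' := by
        rintro r _ ⟨A, hA, rfl⟩
        exact ⟨r • A, M.toSubalgebra.smul_mem hA r, rfl⟩ }
  change Dense (K : Set (FockSpace P.oneParticle))
  rw [Submodule.dense_iff_topologicalClosure_eq_top]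
  refine P.eq_top_of_a_mem hq hd K.isClosed_topologicalClosure
    (K.le_topologicalClosure ⟨1, one_mem M, rfl⟩) fun f hf y hy => ?_
  refine map_mem_closure (P.a f).continuous hy ?_
  rintro _ ⟨A, hA, rfl⟩
  exact ⟨P.a f * A, mul_mem (P.a_mem_vonNeumannAlgebra hq hf) hA, rfl⟩

theorem dense_of_isCyclic {q : Submodule ℂ H} {hq : ∀ f ∈ q, Γ f ∈ q}
    (hc : (P.vonNeumannAlgebra q hq).IsCyclic (vacuum P.oneParticle)) :
    Dense (P.toOneParticle '' (q : Set H)) := by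
  refine P.dense_toOneParticle_image q fun v hv => eq_zero_of_annihilation_eq_zero ?_
  have hB : annihilation v * parity ∈ Set.centralizer (P.a '' (q : Set H)) := by
    refine P.mul_parity_mem_centralizer fun f hf => ?_
    have h1 := P.a_mul_a (v : H) f
    have h2 : ⟪f, Γ (v : H)⟫_ℂ = 0 := by
      rw [Γ.inner_map_right, ← inner_toOneParticle_right]
      exact hv _ (hq f hf)
    rw [h2, zero_smul, zero_sub, a_coe] at h1
    rw [h1, neg_neg]
  -- The operator commutes with $\mathcal M(\mathfrak q)$ and kills $\Omega$, so it vanishes on the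
  -- dense set $\mathcal M(\mathfrak q)\Omega$.
  have h0 : annihilation v * parity = 0 := by
    refine ContinuousLinearMap.ext fun y => ?_
    refine congrFun (Continuous.ext_on hc (annihilation v * parity).continuous
      (0 : FockSpace P.oneParticle →L[ℂ] FockSpace P.oneParticle).continuous ?_) y
    rintro _ ⟨A, hA, rfl⟩
    rw [← mul_apply_eq_comp, P.commute_of_mem_vonNeumannAlgebra hA hB]
    simp
  rw [← mul_one (annihilation v), ← parity_mul_parity, ← mul_assoc, h0, zero_mul]

theorem isSeparating_of_dense {q : Submodule ℂ H} (hq : ∀ f ∈ q, Γ f ∈ q)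
    (hd : Dense (P.toOneParticle '' (qᗮ : Set H))) :
    (P.vonNeumannAlgebra q hq).IsSeparating (vacuum P.oneParticle) := by
  intro A hA hA0
  -- Only $a(g)\theta$, not $a(g)$, commutes with $A$. Hence $Aa(g)y=a(g)\theta A\theta y$ and
  -- $A\theta a(g)y=-a(g)\theta Ay$: each kernel is mapped into the other, and the intersection is
  -- stable.
  let K : Submodule ℂ (FockSpace P.oneParticle) :=
    A.toLinearMap.ker ⊓ (A * parity).toLinearMap.ker
  have mem_K : ∀ y, y ∈ K ↔ A y = 0 ∧ A (parity y) = 0 := fun y => Iff.rfl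
  have hK : IsClosed (K : Set (FockSpace P.oneParticle)) :=
    A.isClosed_ker.inter (A * parity).isClosed_ker
  have hcomm : ∀ g ∈ qᗮ, ∀ y, A (P.a g (parity y)) = P.a g (parity (A y)) := by
    intro g hg y
    have hB : P.a g * parity ∈ Set.centralizer (P.a '' (q : Set H)) := by
      refine P.mul_parity_mem_centralizer fun f hf => ?_
      rw [a_mul_a, Submodule.inner_left_of_mem_orthogonal (hq f hf) hg, zero_smul, zero_sub]
    exact (congrArg (· y) (P.commute_of_mem_vonNeumannAlgebra hA hB)).symm
  have hpp : ∀ y : FockSpace P.oneParticle, parity (parity y) = y := fun y =>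
    congrArg (· y) parity_mul_parity
  have htop : K = ⊤ := by
    refine P.eq_top_of_a_mem (fun g hg => Γ.map_mem_orthogonal hq hg) hd hK ?_ ?_
    · rw [mem_K, parity_vacuum]
      exact ⟨hA0, hA0⟩
    · intro g hg y hy
      obtain ⟨h1, h2⟩ := (mem_K y).1 hy
      refine (mem_K _).2 ⟨?_, ?_⟩
      · rw [← hpp y, hcomm g hg, h2, map_zero, map_zero]
      · have h3 : parity (P.a g y) = -P.a g (parity y) := congrArg (· y) (P.parity_mul_a g)
        rw [h3, map_neg, hcomm g hg, h1, map_zero, map_zero, neg_zero]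
  exact ContinuousLinearMap.ext fun y => ((mem_K y).1 (htop ▸ Submodule.mem_top)).1

theorem dense_of_isSeparating {q : Submodule ℂ H} (hq_closed : IsClosed (q : Set H))
    {hq : ∀ f ∈ q, Γ f ∈ q}
    (hs : (P.vonNeumannAlgebra q hq).IsSeparating (vacuum P.oneParticle)) :
    Dense (P.toOneParticle '' (qᗮ : Set H)) := by
  refine P.dense_toOneParticle_image qᗮ fun v hv => eq_zero_of_annihilation_eq_zero ?_
  -- Closedness of $\mathfrak q$ enters here, through $\mathfrak q^{\perp\perp}=\mathfrak q$.
  have hvq : (v : H) ∈ q := by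
    rw [← hq_closed.submodule_topologicalClosure_eq, ← Submodule.orthogonal_orthogonal_eq_closure,
      Submodule.mem_orthogonal']
    intro g hg
    rw [← inner_toOneParticle_right]
    exact hv g hg
  rw [← a_coe]
  refine hs _ (P.a_mem_vonNeumannAlgebra hq hvq) ?_
  rw [a_coe, annihilation_vacuum]

end BasisProjection

end

theorem mainTheorem9 {H : Type*} [NormedAddCommGroup H] [InnerProductSpace ℂ H] [CompleteSpace H]
    (Γ : AntiunitaryInvolution H) (P : BasisProjection Γ)
    (q : Submodule ℂ H) (hq_closed : IsClosed (q : Set H)) (hq : ∀ f ∈ q, Γ f ∈ q) :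
    ((P.vonNeumannAlgebra q hq).IsCyclic (FockSpace.vacuum P.oneParticle) ↔
        Dense (P.toOneParticle '' (q : Set H))) ∧
      ((P.vonNeumannAlgebra q hq).IsSeparating (FockSpace.vacuum P.oneParticle) ↔
        Dense (P.toOneParticle '' (qᗮ : Set H))) := by
  exact ⟨⟨P.dense_of_isCyclic, P.isCyclic_of_dense hq⟩,
    ⟨P.dense_of_isSeparating hq_closed, P.isSeparating_of_dense hq⟩⟩
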